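/- Let $F=\mathbb F_q$ be a finite field and let $n_1,n_2,k,T\ge 0$ be integers. An $(n_1,n_2,k,T)_q$ streaming code consists, for every time slot $t\in\{0,1,2,\dots\}$, of a source encoder $\mathcal E_S(t):(\mathbb F_q^{k})^{t+1}\to\mathbb F_q^{n_1}$, a relay encoder $\mathcal E_R(t):(\mathbb F_q^{n_1}\cup\{*\})^{t+1}\to\mathbb F_q^{n_2}$ and a decoder $\mathcal D(t):(\mathbb F_q^{n_2}\cup\{*\})^{t+1+T}\to\mathbb F_q^{k}$. For messages $m(0),m(1),\dots\in\mathbb F_q^k$, the source sends $x(t)=\mathcal E_S(t)(m(0),\dots,m(t))$ in slot $t$; the relay receives $x_R(t)=*$ if slot $t$ is erased in the source-relay link and $x_R(t)=x(t)$ otherwise, and sends $y(t)=\mathcal E_R(t)(x_R(0),\dots,x_R(t))$; the destination receives $y_D(t)=*$ if slot $t$ is erased in the relay-destination link and $y_D(t)=y(t)$ otherwise, and computes $\hat m(t)=\mathcal D(t)(y_D(0),\dots,y_D(t+T))$. The rate of the code is $k/\max\{n_1,n_2\}$. An $N$-erasure sequence is a binary sequence indexed by the time slots that erases at most $N$ slots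 in total. The code is $(N_1,N_2,T)$-achievable if $\hat m(t)=m(t)$ for all message sequences and all $t$, for every $N_1$-erasure sequence in the source-relay link and every $N_2$-erasure sequence in the relay-destination link. The code is channel-state-independent if, for every message sequence, the relay packets $y(0),y(1),\dots$ are the same for all $N_1$-erasure sequences in the source-relay link, and channel-state-dependent otherwise. **Corollary.** Let $N_1,N_2,T$ be integers with $1\le N_1<N_2$ and $N_1+N_2\le T$. There is $q_0$ such that for every finite field $\mathbb F_q$ with $q\ge q_0$: 1. for some $n_1,n_2,k$ there is a channel-state-dependent $(N_1,N_2,T)$-achievable $(n_1,n_2,k,T)_q$ streaming code whose rate is strictly greater than $\frac{T+1-N_1-N_2}{T+1-N_1}$; 2. the value $\frac{T+1-N_1-N_2}{T+1-N_1}$ is the rate of some channel-state-independent $(N_1,N_2,T)$-achievable streaming code over $\mathbb F_q$. -/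

import Mathlib

/-- An `(n₁, n₂, k, T)` streaming code over the alphabet `F`: one source encoder, one relay encoder
and one decoder for every time slot. The erasure symbol `*` is `none`. -/
structure StreamingCode (F : Type*) (n₁ n₂ k T : ℕ) where
  /-- The source packet `x(t)` is a function of the messages `m(0), …, m(t)`. -/
  encS : (t : ℕ) → (Fin (t + 1) → (Fin k → F)) → (Fin n₁ → F)
  /-- The relay packet `y(t)` is a function of the packets received by the relay in
  the slots `0, …, t`. -/
  encR : (t : ℕ) → (Fin (t + 1) → Option (Fin n₁ → F)) → (Fin n₂ → F)
  /-- The estimate of `m(t)` is a function of the packets received by the destination in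
  the slots `0, …, t + T`. -/
  dec : (t : ℕ) → (Fin (t + 1 + T) → Option (Fin n₂ → F)) → (Fin k → F)

/-- A binary erasure sequence `e` (`e t = true` iff slot `t` is erased) is an `N`-erasure sequence
if it erases at most `N` slots altogether. -/
def IsErasureSeq (N : ℕ) (e : ℕ → Bool) : Prop :=
  {t : ℕ | e t = true}.encard ≤ (N : ℕ∞)

/-- The packet erasure channel: slot `t` delivers `none` if it is erased, the sent packet
otherwise. -/
def erasureChannel {A : Type*} (e : ℕ → Bool) (x : ℕ → A) (t : ℕ) : Option A :=
  if e t = true then none else some (x t)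

namespace StreamingCode

variable {F : Type*} {n₁ n₂ k T : ℕ}

/-- The source packets `x(t)` for the message sequence `m`. -/
def sourcePacket (C : StreamingCode F n₁ n₂ k T) (m : ℕ → Fin k → F) (t : ℕ) : Fin n₁ → F :=
  C.encS t (fun i => m i)

/-- The relay packets `y(t)` for the message sequence `m` and the source-relay erasure
sequence `eS`. -/
def relayPacket (C : StreamingCode F n₁ n₂ k T) (eS : ℕ → Bool) (m : ℕ → Fin k → F)
    (t : ℕ) : Fin n₂ → F :=
  C.encR t (fun i => erasureChannel eS (C.sourcePacket m) i)

/-- The destination's estimate of the message `m(t)`. -/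
def estimate (C : StreamingCode F n₁ n₂ k T) (eS eR : ℕ → Bool) (m : ℕ → Fin k → F)
    (t : ℕ) : Fin k → F :=
  C.dec t (fun i => erasureChannel eR (C.relayPacket eS m) i)

/-- `(N₁, N₂, T)`-achievability: all messages are perfectly reconstructed under every
`N₁`-erasure sequence in the first link and every `N₂`-erasure sequence in the second. -/
def IsAchievable (C : StreamingCode F n₁ n₂ k T) (N₁ N₂ : ℕ) : Prop :=
  ∀ eS eR : ℕ → Bool, IsErasureSeq N₁ eS → IsErasureSeq N₂ eR →
    ∀ (m : ℕ → Fin k → F) (t : ℕ), C.estimate eS eR m t = m t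

/-- The relaying strategy is channel-state-independent (for `N₁` erasures): the relay packets are
determined by the messages and do not change with the `N₁`-erasure sequence that
occurs in the source-relay link. -/
def IsChannelStateIndependent (C : StreamingCode F n₁ n₂ k T) (N₁ : ℕ) : Prop :=
  ∀ eS eS' : ℕ → Bool, IsErasureSeq N₁ eS → IsErasureSeq N₁ eS' →
    ∀ (m : ℕ → Fin k → F) (t : ℕ), C.relayPacket eS m t = C.relayPacket eS' m t

/-- The rate `k / max {n₁, n₂}`. -/
def rate (_C : StreamingCode F n₁ n₂ k T) : ℚ :=
  (k : ℚ) / (max n₁ n₂ : ℕ)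

end StreamingCode

/-!
Write `A = T + 1 - N₁ - N₂ ≥ 1`; the value to be beaten is `A / (A + N₂)`. All codes below are
systematic maximum-distance-separable (Reed–Solomon) codes, used coordinatewise on vectors of field
elements.

*Source.* The message `m(s)` is cut into `A` pieces and the pieces are encoded by an `(A + N₁, A)`
code along diagonals of time. Whatever the (at most `N₁`) erasures, the relay knows piece `i` of
`m(s)` no later than in slot `s + N₁ + i` (`message_eq_of_diagPacket_eq`), and it knows all of `m(s)`
in slot `s` when that slot is not erased.

*Channel-state-independent relay.* In slot `s + N₁ + p`, for `p < A + N₂`, the relay sends symbol `p`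
of an `(A + N₂, A)` codeword of `m(s)`. A systematic symbol `p` needs only the pieces up to `p`, so
the relay can compute it in time, and any `A` of these symbols give `m(s)` by slot `s + T`. The rate
is exactly `A / (A + N₂)`.

*Channel-state-dependent relay.* The delay `N₁` is only needed for the at most `N₁` messages whose
own slot is erased. A message that arrives is encoded at once by a `(T + 1, A + N₁)` code and spread
over the slots `s, …, s + T`; measured in message sizes this costs `1 / (A + N₁)` per slot. An erased
message is treated as before and costs `1 / A` per slot. As at most `N₁` of the `T + 1` messages
served in a slot are erased, the relay packet has size at most
`(T + 1 - N₁) / (A + N₁) + N₁ / A`, which is smaller than `(A + N₂) / A` because `N₁ < N₂`. A header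
tells the destination which of these messages were erased; its length is constant, so that its share
is negligible once the messages are long enough.

Decoders and relay encoders are not written down: they exist as soon as the received packets
determine the value to be computed (`exists_streamingCode`).
-/

/-! ### Codes from packets that determine what they have to -/

theorem erasureChannel_eq_iff {A : Type*} {e e' : ℕ → Bool} {x x' : ℕ → A} {t : ℕ} :
    erasureChannel e x t = erasureChannel e' x' t ↔ e t = e' t ∧ (e t = false → x t = x' t) := by
  unfold erasureChannel
  cases e t <;> cases e' t <;> simp

theorem IsErasureSeq.card_le {N : ℕ} {e : ℕ → Bool} (he : IsErasureSeq N e) (S : Finset ℕ)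
    (hS : ∀ t ∈ S, e t = true) : S.card ≤ N := by
  have h : (S : Set ℕ).encard ≤ (N : ℕ∞) := (Set.encard_le_encard fun t ht => hS t ht).trans he
  rw [Set.encard_coe_eq_coe_finsetCard] at h
  exact_mod_cast h

/-- Source packets `X` and relay packets `Y` with values in finite-dimensional spaces come from an
achievable streaming code as soon as `X` is causal, the packets received by the relay determine its
packets, and the packets received by the destination within the delay determine the message. -/
theorem exists_streamingCode {F M P Q : Type*} [Field F]
    [AddCommGroup M] [Module F M] [Module.Finite F M]
    [AddCommGroup P] [Module F P] [Module.Finite F P]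
    [AddCommGroup Q] [Module F Q] [Module.Finite F Q] (N₁ N₂ T : ℕ) {n₁ n₂ k : ℕ}
    (hM : Module.finrank F M = k) (hP : Module.finrank F P = n₁) (hQ : Module.finrank F Q = n₂)
    (X : (ℕ → M) → ℕ → P) (Y : (ℕ → Bool) → (ℕ → M) → ℕ → Q)
    (causal : ∀ m m' t, (∀ i ≤ t, m i = m' i) → X m t = X m' t)
    (relay : ∀ eS eS', IsErasureSeq N₁ eS → IsErasureSeq N₁ eS' → ∀ m m' t,
      (∀ i ≤ t, erasureChannel eS (X m) i = erasureChannel eS' (X m') i) →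
        Y eS m t = Y eS' m' t)
    (destination : ∀ eS eS' eR eR', IsErasureSeq N₁ eS → IsErasureSeq N₁ eS' →
      IsErasureSeq N₂ eR → IsErasureSeq N₂ eR' → ∀ m m' t,
      (∀ i ≤ t + T, erasureChannel eR (Y eS m) i = erasureChannel eR' (Y eS' m') i) →
        m t = m' t) :
    ∃ C : StreamingCode F n₁ n₂ k T,
      C.IsAchievable N₁ N₂ ∧
      (C.IsChannelStateIndependent N₁ ↔ ∀ eS eS', IsErasureSeq N₁ eS → IsErasureSeq N₁ eS' →
        ∀ m t, Y eS m t = Y eS' m t) := by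
  let φM : M ≃ₗ[F] (Fin k → F) := LinearEquiv.ofFinrankEq _ _ (by simpa using hM)
  let φP : P ≃ₗ[F] (Fin n₁ → F) := LinearEquiv.ofFinrankEq _ _ (by simpa using hP)
  let φQ : Q ≃ₗ[F] (Fin n₂ → F) := LinearEquiv.ofFinrankEq _ _ (by simpa using hQ)
  have hX : ∀ t, ∃ f : (Fin (t + 1) → (Fin k → F)) → P,
      (fun m : ℕ → Fin k → F => X (fun s => φM.symm (m s)) t) =
        f ∘ fun m i => m i := fun t => by
    refine (Function.factorsThrough_iff _).1 fun m m' h => causal _ _ _ fun i hi => ?_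
    exact congrArg φM.symm (congrFun h ⟨i, Nat.lt_succ_of_le hi⟩)
  choose encS hS using hX
  have hY : ∀ t, ∃ f : (Fin (t + 1) → Option (Fin n₁ → F)) → Q,
      (fun w : {e // IsErasureSeq N₁ e} × (ℕ → M) => Y w.1 w.2 t) =
        f ∘ fun w i => erasureChannel w.1 (fun s => φP (X w.2 s)) i := fun t => by
    refine (Function.factorsThrough_iff _).1 fun w w' h =>
      relay _ _ w.1.2 w'.1.2 _ _ _ fun i hi => ?_
    have := erasureChannel_eq_iff.1 (congrFun h ⟨i, Nat.lt_succ_of_le hi⟩)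
    exact erasureChannel_eq_iff.2 ⟨this.1, fun hf => φP.injective (this.2 hf)⟩
  choose encR hR using hY
  have hD : ∀ t, ∃ f : (Fin (t + 1 + T) → Option (Fin n₂ → F)) → M,
      (fun w : ({e // IsErasureSeq N₁ e} × {e // IsErasureSeq N₂ e}) × (ℕ → M) => w.2 t) =
        f ∘ fun w i => erasureChannel w.1.2 (fun s => φQ (Y w.1.1 w.2 s)) i := fun t => by
    refine (Function.factorsThrough_iff _).1 fun w w' h =>
      destination _ _ w.1.2 w'.1.2 w.1.1.2 w'.1.1.2 w.1.2.2 w'.1.2.2 _ _ _ fun i hi => ?_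
    have := erasureChannel_eq_iff.1 (congrFun h ⟨i, by omega⟩)
    exact erasureChannel_eq_iff.2 ⟨this.1, fun hf => φQ.injective (this.2 hf)⟩
  choose dec hdec using hD
  let C : StreamingCode F n₁ n₂ k T :=
    { encS := fun t v => φP (encS t v)
      encR := fun t v => φQ (encR t v)
      dec := fun t v => φM (dec t v) }
  have source_eq : ∀ m t, C.sourcePacket m t = φP (X (fun s => φM.symm (m s)) t) := fun m t =>
    congrArg φP (congrFun (hS t) m).symm
  have relay_eq : ∀ eS, IsErasureSeq N₁ eS → ∀ m t,
      C.relayPacket eS m t = φQ (Y eS (fun s => φM.symm (m s)) t) := fun eS he m t => by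
    have h := congrFun (hR t) (⟨eS, he⟩, fun s => φM.symm (m s))
    simp only [Function.comp_apply] at h
    rw [h]
    unfold StreamingCode.relayPacket
    rw [funext (source_eq m)]
  refine ⟨C, fun eS eR hes her m t => ?_, fun h eS eS' he he' m t => ?_,
    fun h eS eS' he he' m t => ?_⟩
  · have h := congrFun (hdec t) ((⟨eS, hes⟩, ⟨eR, her⟩), fun s => φM.symm (m s))
    simp only [Function.comp_apply] at h
    rw [LinearEquiv.symm_apply_eq] at h
    rw [h]
    unfold StreamingCode.estimate
    rw [funext (relay_eq eS hes m)]
  · have := h eS eS' he he' (fun s => φM (m s)) t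
    rw [relay_eq _ he, relay_eq _ he'] at this
    simpa using φQ.injective this
  · rw [relay_eq _ he, relay_eq _ he', h eS eS' he he']

/-! ### Systematic MDS codes -/

/-- A systematic code with `K` information symbols and length `n` over the alphabet `V` that
corrects any `n - K` erasures. Codeword positions are natural numbers; those from `n` on
are meaningless. -/
structure MDSCode (K n : ℕ) (V : Type*) where
  /-- The codeword of an information word. -/
  enc : (Fin K → V) → ℕ → V
  systematic : ∀ u (i : Fin K), enc u i = u i
  determined : ∀ u u' (P : Finset ℕ), P ⊆ Finset.range n → K ≤ P.card →
    (∀ p ∈ P, enc u p = enc u' p) → u = u'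

namespace MDSCode

variable {K n N : ℕ} {V : Type*}

/-- A code used coordinatewise on vectors. -/
def pi (c : MDSCode K n V) (ι : Type*) : MDSCode K n (ι → V) where
  enc u p := fun l => c.enc (fun i => u i l) p
  systematic u i := funext fun _ => c.systematic _ i
  determined u u' P hP hK h := by
    funext i l
    exact congrFun (c.determined (fun i => u i l) (fun i => u' i l) P hP hK
      fun p hp => congrFun (h p hp) l) i

/-- Symbol `p` of a codeword depends only on the information symbols `0, …, p`. -/
theorem enc_congr (c : MDSCode K n V) {u u' : Fin K → V} {p : ℕ}
    (h : ∀ i : Fin K, (i : ℕ) ≤ p → u i = u' i) : c.enc u p = c.enc u' p := by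
  by_cases hp : p < K
  · exact (c.systematic u ⟨p, hp⟩).trans ((h ⟨p, hp⟩ le_rfl).trans (c.systematic u' ⟨p, hp⟩).symm)
  · rw [funext fun i : Fin K => h i (by omega)]

/-- A codeword whose symbol `p` is sent in slot `a + p - b` survives `N` erased slots, if the symbols
with `a + p < b`, which belong to no slot, are known. -/
theorem eq_of_erasures (c : MDSCode K n V) (hn : K + N ≤ n) {e : ℕ → Bool}
    (he : IsErasureSeq N e) {u u' : Fin K → V} (a b : ℕ)
    (h : ∀ p < n, (b ≤ a + p → e (a + p - b) = false) → c.enc u p = c.enc u' p) : u = u' := by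
  classical
  refine c.determined u u' ((Finset.range n).filter fun p => b ≤ a + p → e (a + p - b) = false)
    (Finset.filter_subset _ _) ?_ fun p hp => ?_
  · have hcard := Finset.card_filter_add_card_filter_not (s := Finset.range n)
      (fun p => b ≤ a + p → e (a + p - b) = false)
    have hlost : ((Finset.range n).filter
        fun p => ¬ (b ≤ a + p → e (a + p - b) = false)).card ≤ N := by
      rw [← Finset.card_image_of_injOn (f := fun p => a + p - b)]
      · refine he.card_le _ fun t ht => ?_
        obtain ⟨p, hp, rfl⟩ := Finset.mem_image.1 ht
        have := (Finset.mem_filter.1 hp).2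
        simp only [Classical.not_imp, Bool.not_eq_false] at this
        exact this.2
      · intro p hp q hq hpq
        have hp' := (Finset.mem_filter.1 hp).2
        have hq' := (Finset.mem_filter.1 hq).2
        simp only [Classical.not_imp] at hp' hq'
        have := hp'.1
        have := hq'.1
        simp only at hpq
        omega
    rw [Finset.card_range] at hcard
    omega
  · exact h p (Finset.mem_range.1 (Finset.mem_filter.1 hp).1) (Finset.mem_filter.1 hp).2

end MDSCode

/-- Systematic Reed–Solomon codes: the codeword consists of the values of the polynomial of
degree less than `K` that interpolates the information word. -/
theorem nonempty_mdsCode (F : Type*) [Field F] [Fintype F] {K n : ℕ} (hK : K ≤ n)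
    (hn : n ≤ Fintype.card F) : Nonempty (MDSCode K n F) := by
  obtain ⟨g⟩ : Nonempty (Fin n ↪ F) :=
    Function.Embedding.nonempty_of_card_le (by simpa using hn)
  let a : ℕ → F := fun p => if h : p < n then g ⟨p, h⟩ else 0
  have ha : ∀ p < n, ∀ q < n, a p = a q → p = q := fun p hp q hq h => by
    simp only [a, hp, hq, dif_pos] at h
    simpa using g.injective h
  have hinj : Set.InjOn (fun i : Fin K => a i) (Finset.univ : Finset (Fin K)) :=
    fun i _ j _ h => Fin.ext (ha i (by omega) j (by omega) h)
  refine ⟨fun u p => (Lagrange.interpolate Finset.univ (fun i : Fin K => a i) u).eval (a p),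
    fun u i => Lagrange.eval_interpolate_at_node u hinj (Finset.mem_univ i),
    fun u u' P hP hKP h => ?_⟩
  have hdeg : ∀ w, (Lagrange.interpolate Finset.univ (fun i : Fin K => a i) w).degree < P.card :=
    fun w => (Lagrange.degree_interpolate_lt w hinj).trans_le (by simpa using hKP)
  have heq := Polynomial.eq_of_degrees_lt_of_eval_index_eq P
    (fun p hp q hq hpq => ha p (Finset.mem_range.1 (hP hp)) q (Finset.mem_range.1 (hP hq)) hpq)
    (hdeg u) (hdeg u') h
  funext i
  rw [← Lagrange.eval_interpolate_at_node u hinj (Finset.mem_univ i), heq,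
    Lagrange.eval_interpolate_at_node u' hinj (Finset.mem_univ i)]

/-! ### The diagonally interleaved source code -/

section Source

variable {A N n : ℕ} {V : Type*} [Zero V]

/-- The information word of the diagonal whose symbol `p` is sent in slot `t`: its symbol `j` is
sent in slot `t + j - p` and is a piece of the message of that slot. The pieces are taken in reverse
order, and messages before slot `0` are zero. -/
def diagWord (m : ℕ → Fin A → V) (t p : ℕ) : Fin A → V :=
  fun j => if p ≤ t + j then m (t + j - p) j.rev else 0

/-- The source packet of slot `t`: symbol `p` belongs to the diagonal that is in position `p`
in slot `t`. -/
def diagPacket (c : MDSCode A n V) (m : ℕ → Fin A → V) (t : ℕ) : Fin n → V :=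
  fun p => c.enc (diagWord m t p) p

theorem diagPacket_causal (c : MDSCode A n V) (m m' : ℕ → Fin A → V) (t : ℕ)
    (h : ∀ i ≤ t, m i = m' i) : diagPacket c m t = diagPacket c m' t := by
  funext p
  refine c.enc_congr fun i hi => ?_
  simp only [diagWord, h (t + i - p) (by omega)]

theorem message_eq_of_diagPacket_eq_self (c : MDSCode A n V) (hn : A ≤ n) {m m' : ℕ → Fin A → V}
    {s : ℕ} (h : diagPacket c m s = diagPacket c m' s) : m s = m' s := by
  funext i
  have hi := congrFun h ⟨i.rev, i.rev.isLt.trans_le hn⟩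
  simp only [diagPacket] at hi
  rw [c.systematic, c.systematic] at hi
  simpa [diagWord] using hi

/-- The relay knows piece `i` of the message `m(s)` in slot `s + N + i`, whichever `N` slots are
erased: this piece lies on a diagonal that ends in that slot. -/
theorem message_eq_of_diagPacket_eq (c : MDSCode A (A + N) V) {e : ℕ → Bool}
    (he : IsErasureSeq N e) {m m' : ℕ → Fin A → V} {t : ℕ}
    (h : ∀ u ≤ t, e u = false → diagPacket c m u = diagPacket c m' u) {s : ℕ} {i : Fin A}
    (hs : s + N + i ≤ t) : m s i = m' s i := by
  have hrev : (i.rev : ℕ) + i + 1 = A := by rw [Fin.val_rev]; omega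
  have key : diagWord m s i.rev = diagWord m' s i.rev := by
    refine c.eq_of_erasures le_rfl he s i.rev fun p hp hep => ?_
    by_cases hsp : (i.rev : ℕ) ≤ s + p
    · have hu := congrFun (h (s + p - i.rev) (by omega) (hep hsp)) ⟨p, hp⟩
      have hw : ∀ w : ℕ → Fin A → V, diagWord w (s + p - i.rev) p = diagWord w s i.rev :=
        fun w => by
          funext j
          have h1 : p ≤ s + p - i.rev + j ↔ (i.rev : ℕ) ≤ s + j := by omega
          have h2 : s + p - i.rev + j - p = s + j - i.rev := by omega
          simp only [diagWord, h1, h2]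
      simpa only [diagPacket, hw] using hu
    · -- The symbol precedes slot `0`, so that it is a systematic symbol equal to zero.
      have hpA : p < A := by omega
      have h0 : ∀ w : ℕ → Fin A → V, c.enc (diagWord w s i.rev) p = 0 := fun w => by
        have := c.systematic (diagWord w s i.rev) ⟨p, hpA⟩
        simp only [diagWord, hsp, if_false] at this
        exact this
      rw [h0, h0]
  simpa [diagWord] using congrFun key i.rev

end Source

/-! ### The channel-state-independent relay -/

section Independent

variable {A N₁ N₂ n : ℕ} {V : Type*} [Zero V]

/-- The relay packet of slot `t` when every message is forwarded with delay `N₁`: its symbol `p` is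
symbol `p` of the codeword of the message `m(t - N₁ - p)`. -/
def delayedPacket (N₁ : ℕ) (c : MDSCode A n V) (m : ℕ → Fin A → V) (t : ℕ) : Fin n → V :=
  fun p => if N₁ + p ≤ t then c.enc (m (t - N₁ - p)) p else 0

theorem exists_channelStateIndependent (F : Type*) [Field F] (T : ℕ) (hT : A + N₁ + N₂ = T + 1)
    (c₁ : MDSCode A (A + N₁) F) (c₂ : MDSCode A (A + N₂) F) :
    ∃ C : StreamingCode F (A + N₁) (A + N₂) A T,
      C.IsAchievable N₁ N₂ ∧ C.IsChannelStateIndependent N₁ := by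
  have := exists_streamingCode (F := F) N₁ N₂ T (Module.finrank_fin_fun F)
    (Module.finrank_fin_fun F) (Module.finrank_fin_fun F) (diagPacket c₁)
    (fun _ m t => delayedPacket N₁ c₂ m t) (diagPacket_causal c₁) ?_ ?_
  · obtain ⟨C, h1, h2⟩ := this
    exact ⟨C, h1, h2.2 fun _ _ _ _ _ _ => rfl⟩
  · intro eS eS' he _ m m' t h
    funext p
    simp only [delayedPacket]
    split_ifs with hp
    · exact c₂.enc_congr fun i hi => message_eq_of_diagPacket_eq c₁ he
        (fun u hu => (erasureChannel_eq_iff.1 (h u hu)).2) (t := t) (by omega)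
    · rfl
  · intro eS eS' eR eR' _ _ he _ m m' s h
    refine c₂.eq_of_erasures le_rfl he (s + N₁) 0 fun p hp hep => ?_
    have h1 := (erasureChannel_eq_iff.1 (h (s + N₁ + p) (by omega))).2
      (by simpa using hep (Nat.zero_le _))
    have h2 := congrFun h1 ⟨p, hp⟩
    have h3 : N₁ + p ≤ s + N₁ + p := by omega
    have h4 : s + N₁ + p - N₁ - p = s := by omega
    simpa only [delayedPacket, h3, h4, if_true] using h2

end Independent

/-! ### The channel-state-dependent relay -/

section Dependent

variable {A N₁ N₂ T : ℕ} {V : Type*} [Zero V]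

/-- The number of erased slots before slot `s`, which numbers the erased slots. -/
def erasureRank (e : ℕ → Bool) (s : ℕ) : ℕ :=
  Nat.count (fun u => e u = true) s

/-- The erased slot that is preceded by `r` erased slots; a junk value if there is none. -/
noncomputable def erasedSlot (e : ℕ → Bool) (r : ℕ) : ℕ :=
  Nat.nth (fun u => e u = true) r

theorem erasureRank_congr {e e' : ℕ → Bool} {s : ℕ} (h : ∀ u < s, e u = e' u) :
    erasureRank e s = erasureRank e' s := by
  simp only [erasureRank, Nat.count_eq_card_filter_range]
  congr 1
  exact Finset.filter_congr fun u hu => by rw [h u (Finset.mem_range.1 hu)]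

theorem erasedSlot_erasureRank {e : ℕ → Bool} {s : ℕ} (hs : e s = true) :
    erasedSlot e (erasureRank e s) = s :=
  Nat.nth_count hs

theorem IsErasureSeq.erasureRank_lt {N : ℕ} {e : ℕ → Bool} (he : IsErasureSeq N e) {s : ℕ}
    (hs : e s = true) : erasureRank e s < N := by
  have h := he.card_le ((Finset.range (s + 1)).filter fun u => e u = true)
    fun t ht => (Finset.mem_filter.1 ht).2
  rw [← Nat.count_eq_card_filter_range, Nat.count_succ, if_pos hs] at h
  exact h

/-- The header of slot `t`: entry `(d, r)` is `1` if slot `t - d` was erased and has rank `r` among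
the erased slots, and `0` otherwise. -/
def header (F : Type*) [Zero F] [One F] (T N₁ : ℕ) (e : ℕ → Bool) (t : ℕ) :
    Fin (T + 1) → Fin N₁ → F :=
  fun d r => if d ≤ t ∧ e (t - d) = true ∧ erasureRank e (t - d) = r then 1 else 0

/-- The part of the relay packet of slot `t` with one block for each of the messages
`m(t - d)`, `d ≤ T`. A message that arrived is sent with the code `cU` from slot `t - d` on. An
erased one is sent with the code `cE` from slot `t - d + N₁` on, and the block holds the first `A`
of the `A + N₁` entries of the code symbol. -/
def basePacket (T : ℕ) {nU nE : ℕ} (cU : MDSCode (A + N₁) nU (Fin A → V))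
    (cE : MDSCode A nE (Fin (A + N₁) → V)) (e : ℕ → Bool)
    (m : ℕ → Fin A → Fin (A + N₁) → V) (t : ℕ) : Fin (T + 1) → Fin A → V :=
  fun d => if d ≤ t then
    if e (t - d) = true then
      if N₁ ≤ d then fun a => cE.enc (m (t - d)) (d - N₁) (Fin.castAdd N₁ a) else 0
    else cU.enc (fun b a => m (t - d) a b) d
  else 0

/-- The part of the relay packet of slot `t` that holds the last `N₁` entries of the code symbols of
the erased messages; block `r` belongs to the erased slot of rank `r`. -/
noncomputable def extraPacket {nE : ℕ} (cE : MDSCode A nE (Fin (A + N₁) → V)) (e : ℕ → Bool)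
    (m : ℕ → Fin A → Fin (A + N₁) → V) (t : ℕ) : Fin N₁ → Fin N₁ → V :=
  fun r =>
    -- The first two conditions exclude the junk value of `erasedSlot`.
    if e (erasedSlot e r) = true ∧ erasureRank e (erasedSlot e r) = r ∧ erasedSlot e r + N₁ ≤ t then
      fun a => cE.enc (m (erasedSlot e r)) (t - N₁ - erasedSlot e r) (Fin.natAdd A a)
    else 0

theorem header_congr (F : Type*) [Zero F] [One F] {e e' : ℕ → Bool} {t : ℕ}
    (h : ∀ u ≤ t, e u = e' u) : header F T N₁ e t = header F T N₁ e' t := by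
  funext d r
  simp only [header]
  rw [h (t - d) (by omega), erasureRank_congr fun u hu => h u (by omega)]

/-- A header shows which of the last `T + 1` slots were erased, and their ranks. -/
theorem erasure_of_header_eq {F : Type*} [Zero F] [One F] [NeZero (1 : F)] {e e' : ℕ → Bool}
    (he : IsErasureSeq N₁ e) {s t : ℕ} (hst : s ≤ t) (htT : t ≤ s + T)
    (h : header F T N₁ e t = header F T N₁ e' t) (hs : e s = true) :
    e' s = true ∧ erasureRank e' s = erasureRank e s := by
  have h1 := congrFun (congrFun h ⟨t - s, by omega⟩) ⟨erasureRank e s, he.erasureRank_lt hs⟩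
  have h2 : t - (t - s) = s := by omega
  simp only [header, h2, hs, Nat.sub_le, true_and, if_true] at h1
  by_contra hcon
  rw [if_neg hcon] at h1
  exact one_ne_zero h1

theorem basePacket_congr {nU nE : ℕ} (cU : MDSCode (A + N₁) nU (Fin A → V))
    (cE : MDSCode A nE (Fin (A + N₁) → V)) {e e' : ℕ → Bool}
    {m m' : ℕ → Fin A → Fin (A + N₁) → V} {t : ℕ} (he : ∀ u ≤ t, e u = e' u)
    (harrived : ∀ u ≤ t, e u = false → m u = m' u)
    (hpiece : ∀ s (i : Fin A), s + N₁ + i ≤ t → m s i = m' s i) :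
    basePacket T cU cE e m t = basePacket T cU cE e' m' t := by
  funext d
  simp only [basePacket, he (t - d) (Nat.sub_le _ _)]
  split_ifs with h1 h2 h3
  · funext a
    rw [cE.enc_congr fun i hi => hpiece (t - d) i (by omega)]
  · rfl
  · rw [harrived (t - d) (Nat.sub_le _ _) (by rw [he _ (Nat.sub_le _ _)]; simpa using h2)]
  · rfl

theorem extraPacket_congr {nE : ℕ} (cE : MDSCode A nE (Fin (A + N₁) → V)) {e e' : ℕ → Bool}
    {m m' : ℕ → Fin A → Fin (A + N₁) → V} {t : ℕ} (he : ∀ u ≤ t, e u = e' u)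
    (hpiece : ∀ s (i : Fin A), s + N₁ + i ≤ t → m s i = m' s i) :
    extraPacket cE e m t = extraPacket cE e' m' t := by
  have hslot : ∀ {f f' : ℕ → Bool}, (∀ u ≤ t, f u = f' u) → ∀ {r : ℕ},
      f (erasedSlot f r) = true ∧ erasureRank f (erasedSlot f r) = r ∧ erasedSlot f r + N₁ ≤ t →
      erasedSlot f' r = erasedSlot f r ∧ (f' (erasedSlot f' r) = true ∧
        erasureRank f' (erasedSlot f' r) = r ∧ erasedSlot f' r + N₁ ≤ t) := by
    intro f f' hf r h
    have h1 : f' (erasedSlot f r) = true := by rw [← hf _ (by omega)]; exact h.1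
    have h2 : erasureRank f' (erasedSlot f r) = r := by
      rw [← erasureRank_congr fun u hu => hf u (by omega)]; exact h.2.1
    have h3 : erasedSlot f' r = erasedSlot f r := by
      have := erasedSlot_erasureRank h1
      rwa [h2] at this
    rw [h3]
    exact ⟨rfl, h1, h2, h.2.2⟩
  funext r
  simp only [extraPacket]
  split_ifs with h h' h'
  · rw [(hslot he h).1]
    funext a
    rw [cE.enc_congr fun i hi => hpiece _ i (by omega)]
  · exact absurd (hslot he h).2 h'
  · exact absurd (hslot (fun u hu => (he u hu).symm) h').2 h
  · rfl

theorem basePacket_of_arrived {nU nE : ℕ} (cU : MDSCode (A + N₁) nU (Fin A → V))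
    (cE : MDSCode A nE (Fin (A + N₁) → V)) {e : ℕ → Bool} (m : ℕ → Fin A → Fin (A + N₁) → V)
    {s d : ℕ} (hd : d < T + 1) (hs : e s = false) :
    basePacket T cU cE e m (s + d) ⟨d, hd⟩ = cU.enc (fun b a => m s a b) d := by
  simp [basePacket, hs]

/-- The base block and the extra block of an erased message together hold its code symbol. -/
theorem enc_of_erased {nU nE : ℕ} (cU : MDSCode (A + N₁) nU (Fin A → V))
    (cE : MDSCode A nE (Fin (A + N₁) → V)) {e : ℕ → Bool} (m : ℕ → Fin A → Fin (A + N₁) → V)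
    {s p : ℕ} (hp : N₁ + p < T + 1) (hs : e s = true) (hr : erasureRank e s < N₁) :
    cE.enc (m s) p = Fin.addCases (basePacket T cU cE e m (s + N₁ + p) ⟨N₁ + p, hp⟩)
      (extraPacket cE e m (s + N₁ + p) ⟨erasureRank e s, hr⟩) := by
  have h1 : N₁ + p ≤ s + N₁ + p := by omega
  have h2 : s + N₁ + p - (N₁ + p) = s := by omega
  have h3 : s + N₁ ≤ s + N₁ + p := by omega
  have h4 : s + N₁ + p - N₁ - s = p := by omega
  funext b
  refine Fin.addCases (fun a => ?_) (fun a => ?_) b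
  · simp [basePacket, h1, h2, hs]
  · simp [extraPacket, erasedSlot_erasureRank hs, hs, h4]

end Dependent

theorem exists_not_channelStateIndependent (F : Type*) [Field F] {A N₁ N₂ T : ℕ} (L : ℕ)
    (hN₁ : 0 < N₁) (hT : A + N₁ + N₂ = T + 1)
    (c₁ : MDSCode A (A + N₁) F) (cE : MDSCode A (A + N₂) F) (cU : MDSCode (A + N₁) (T + 1) F) :
    ∃ C : StreamingCode F ((A + N₁) * ((A + N₁) * L))
        ((T + 1) * N₁ + ((T + 1) * (A * L) + N₁ * (N₁ * L))) (A * ((A + N₁) * L)) T,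
      C.IsAchievable N₁ N₂ ∧ ¬ C.IsChannelStateIndependent N₁ := by
  let c₁' := (c₁.pi (Fin L)).pi (Fin (A + N₁))
  let cE' := (cE.pi (Fin L)).pi (Fin (A + N₁))
  let cU' := (cU.pi (Fin L)).pi (Fin A)
  have := exists_streamingCode (F := F) N₁ N₂ T (k := A * ((A + N₁) * L))
    (n₁ := (A + N₁) * ((A + N₁) * L)) (n₂ := (T + 1) * N₁ + ((T + 1) * (A * L) + N₁ * (N₁ * L)))
    (by simp [Module.finrank_pi_fintype]) (by simp [Module.finrank_pi_fintype])
    (by simp [Module.finrank_prod, Module.finrank_pi_fintype]) (diagPacket c₁')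
    (fun e m t => (header F T N₁ e t, basePacket T cU' cE' e m t, extraPacket cE' e m t))
    (diagPacket_causal c₁') ?_ ?_
  · obtain ⟨C, h1, h2⟩ := this
    refine ⟨C, h1, fun h => ?_⟩
    -- The header of slot `0` shows whether this slot is erased.
    have h3 := h2.1 h (fun _ => false) (fun u => decide (u = 0)) (by simp [IsErasureSeq])
      (by simp [IsErasureSeq]; exact hN₁) 0 0
    have h4 := congrFun (congrFun (congrArg Prod.fst h3) 0) ⟨0, hN₁⟩
    simp [header, erasureRank] at h4
  · intro e e' he _ m m' t h
    have hee : ∀ u ≤ t, e u = e' u := fun u hu => (erasureChannel_eq_iff.1 (h u hu)).1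
    have hx : ∀ u ≤ t, e u = false → diagPacket c₁' m u = diagPacket c₁' m' u :=
      fun u hu => (erasureChannel_eq_iff.1 (h u hu)).2
    have hpiece : ∀ s (i : Fin A), s + N₁ + i ≤ t → m s i = m' s i :=
      fun s i => message_eq_of_diagPacket_eq c₁' he hx
    have harrived : ∀ u ≤ t, e u = false → m u = m' u := fun u hu hu' =>
      message_eq_of_diagPacket_eq_self c₁' (Nat.le_add_right _ _) (hx u hu hu')
    exact Prod.ext (header_congr F hee)
      (Prod.ext (basePacket_congr cU' cE' hee harrived hpiece) (extraPacket_congr cE' hee hpiece))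
  · intro e e' eR eR' he he' hR _ m m' s h
    have hy : ∀ u ≤ s + T, eR u = false →
        header F T N₁ e u = header F T N₁ e' u ∧
        basePacket T cU' cE' e m u = basePacket T cU' cE' e' m' u ∧
        extraPacket cE' e m u = extraPacket cE' e' m' u := fun u hu hu' => by
      simpa only [Prod.mk.injEq] using (erasureChannel_eq_iff.1 (h u hu)).2 hu'
    -- Some packet of the window arrives, since `N₂ < T + 1`.
    obtain ⟨u, hsu, huT, hu⟩ : ∃ u, s ≤ u ∧ u ≤ s + T ∧ eR u = false := by
      by_contra! hcon
      have := hR.card_le (Finset.Icc s (s + T)) fun u hu => by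
        rw [Finset.mem_Icc] at hu
        simpa using hcon u hu.1 hu.2
      rw [Nat.card_Icc] at this
      omega
    have hhead := (hy u huT hu).1
    cases hs : e s
    · have hs' : e' s = false := by
        by_contra hcon
        have := (erasure_of_header_eq he' hsu huT hhead.symm (by simpa using hcon)).1
        rw [hs] at this
        exact absurd this (by decide)
      have hswap : (fun b a => m s a b) = fun b a => m' s a b := by
        refine cU'.eq_of_erasures (by omega) hR s 0 fun d hd hed => ?_
        have := congrFun (hy (s + d) (by omega) (by simpa using hed (Nat.zero_le _))).2.1 ⟨d, hd⟩
        rwa [basePacket_of_arrived cU' cE' m hd hs, basePacket_of_arrived cU' cE' m' hd hs'] at this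
      funext a b
      exact congrFun (congrFun hswap b) a
    · obtain ⟨hs', hrank⟩ := erasure_of_header_eq he hsu huT hhead hs
      refine cE'.eq_of_erasures le_rfl hR (s + N₁) 0 fun p hp hep => ?_
      have hp' : N₁ + p < T + 1 := by omega
      obtain ⟨-, hb, hx⟩ := hy (s + N₁ + p) (by omega) (by simpa using hep (Nat.zero_le _))
      rw [enc_of_erased cU' cE' m hp' hs (he.erasureRank_lt hs),
        enc_of_erased cU' cE' m' hp' hs' (he'.erasureRank_lt hs'), hb, hx]
      simp only [hrank]

/-! ### Rates -/

theorem mainTheorem2 (N₁ N₂ T : ℕ) (hN₁ : 1 ≤ N₁) (hN : N₁ < N₂) (hT : N₁ + N₂ ≤ T) :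
    ∃ q₀ : ℕ, ∀ (F : Type*) [Field F] [Fintype F], q₀ ≤ Fintype.card F →
      (∃ (n₁ n₂ k : ℕ) (C : StreamingCode F n₁ n₂ k T),
        C.IsAchievable N₁ N₂ ∧ ¬ C.IsChannelStateIndependent N₁ ∧
          ((T : ℚ) + 1 - N₁ - N₂) / ((T : ℚ) + 1 - N₁) < C.rate) ∧
      (∃ (n₁ n₂ k : ℕ) (C : StreamingCode F n₁ n₂ k T),
        C.IsAchievable N₁ N₂ ∧ C.IsChannelStateIndependent N₁ ∧
          C.rate = ((T : ℚ) + 1 - N₁ - N₂) / ((T : ℚ) + 1 - N₁)) := by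
  obtain ⟨A, hA⟩ : ∃ A, A + N₁ + N₂ = T + 1 := ⟨T + 1 - N₁ - N₂, by omega⟩
  have hApos : 0 < A := by omega
  have hTQ : (T : ℚ) + 1 = A + N₁ + N₂ := by exact_mod_cast hA.symm
  have hvalue : ((T : ℚ) + 1 - N₁ - N₂) / ((T : ℚ) + 1 - N₁) = (A : ℚ) / (A + N₂ : ℕ) := by
    rw [hTQ]; push_cast; congr 1 <;> ring
  refine ⟨T + 1, fun F _ _ hF => ?_⟩
  rw [hvalue]
  obtain ⟨c₁⟩ := nonempty_mdsCode F (K := A) (n := A + N₁) (by omega) (by omega)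
  obtain ⟨cE⟩ := nonempty_mdsCode F (K := A) (n := A + N₂) (by omega) (by omega)
  obtain ⟨cU⟩ := nonempty_mdsCode F (K := A + N₁) (n := T + 1) (by omega) hF
  constructor
  · -- Without the header the relay packet has `N₁ * (N₂ - N₁) * L` entries less than
    -- `k * (A + N₂) / A`. The header has `(T + 1) * N₁` entries, so that one more is enough for `L`.
    obtain ⟨C, h1, h2⟩ := exists_not_channelStateIndependent F ((T + 1) * N₁ + 1) hN₁ hA
      c₁ cE cU
    refine ⟨_, _, _, C, h1, h2, ?_⟩
    rw [StreamingCode.rate, div_lt_div_iff₀ (by positivity) (by positivity)]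
    norm_cast
    set H := (T + 1) * N₁
    rw [← hA]
    obtain ⟨D, rfl⟩ : ∃ D, N₂ = N₁ + 1 + D := ⟨N₂ - N₁ - 1, by omega⟩
    rw [mul_max_of_nonneg _ _ (Nat.zero_le _), max_lt_iff]
    constructor
    · have : A + N₁ < A + (N₁ + 1 + D) := by omega
      calc A * ((A + N₁) * ((A + N₁) * (H + 1)))
          = A * ((A + N₁) * (H + 1)) * (A + N₁) := by ring
        _ < A * ((A + N₁) * (H + 1)) * (A + (N₁ + 1 + D)) := by gcongr
    · have hH : H < N₁ * (1 + D) * (H + 1) :=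
        calc H < 1 * (H + 1) := by omega
          _ ≤ N₁ * (1 + D) * (H + 1) := by
            gcongr
            exact Nat.mul_pos hN₁ (by omega)
      calc A * (H + ((A + N₁ + (N₁ + 1 + D)) * (A * (H + 1)) + N₁ * (N₁ * (H + 1))))
          < A * (N₁ * (1 + D) * (H + 1) +
              ((A + N₁ + (N₁ + 1 + D)) * (A * (H + 1)) + N₁ * (N₁ * (H + 1)))) := by gcongr
        _ = A * ((A + N₁) * (H + 1)) * (A + (N₁ + 1 + D)) := by ring
  · obtain ⟨C, h1, h2⟩ := exists_channelStateIndependent F T hA c₁ cE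
    refine ⟨_, _, _, C, h1, h2, ?_⟩
    rw [StreamingCode.rate, max_eq_right (by omega)]
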